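/- **Conventions.** All vector spaces are over $\mathbb C$. A *vertex algebra* is a space $V$ with a linear map $u\mapsto Y(u,z)=\sum_{n\in\mathbb Z}u_nz^{-n-1}\in(\operatorname{End}V)[[z,z^{-1}]]$ and a vector $\mathbf 1$ such that $Y(\mathbf 1,z)=\mathrm{id}$, $u_n\mathbf 1=\delta_{n,-1}u$ for $n\ge-1$, $u_nv=0$ for $n\gg0$, and the Jacobi identity holds. A vector $\omega\in V$ is *conformal* if the operators $L(n)=\omega_{n+1}$ satisfy the Virasoro relations for some central charge $c\in\mathbb C$, $L(-1)v=v_{-2}\mathbf 1$ for all $v$, $V$ is the direct sum of the eigenspaces of $L(0)$, and each $L(n)$, $n\ge1$, is locally nilpotent. $(V,\omega)$ is a *vertex operator algebra* if moreover the eigenvalues of $L(0)$ are integers, the eigenspaces $V_n$ are finite-dimensional, and $V_n=0$ for $n\ll0$. An *automorphism* of $(V,\omega)$ is a linear automorphism $g$ of $V$ with $g\mathbf 1=\mathbf 1$, $g(u_nv)=(gu)_n(gv)$ and $g\omega=\omega$. Let $g$ be an automorphism of finite order $T_g$, and for $0\le r<T_g$ let $V^r=\{v: gv=e^{-2\pi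 i r/T_g}v\}$. A *weak $g$-twisted module* is a space $M$ with a linear map $Y_M(\cdot,z)\colon V\to(\operatorname{End}M)[[z^{1/T_g},z^{-1/T_g}]]$ such that $Y_M(u,z)=\sum_{n\in r/T_g+\mathbb Z}u_nz^{-n-1}$ for $u\in V^r$, $Y_M(\mathbf 1,z)=\mathrm{id}$, $u_nw=0$ for $n\gg0$, and for $u\in V^r$, $v\in V$ $$z_0^{-1}\delta\!\left(\tfrac{z_1-z_2}{z_0}\right)Y_M(u,z_1)Y_M(v,z_2)-z_0^{-1}\delta\!\left(\tfrac{z_2-z_1}{-z_0}\right)Y_M(v,z_2)Y_M(u,z_1)=z_2^{-1}\left(\tfrac{z_1-z_0}{z_2}\right)^{-r/T_g}\!\delta\!\left(\tfrac{z_1-z_0}{z_2}\right)Y_M(Y(u,z_0)v,z_2).$$ This notion does not involve $\omega$. Write $L_M(n)=\omega_{n+1}$ and $L'_M(n)=\omega'_{n+1}$ for the operators on $M$ coming from conformal vectors $\omega,\omega'$. The *twisted Zhu algebra* is $A_g(V,\omega)=V/O_g(V,\omega)$, where $O_g(V,\omega)$ is spanned by all $L(-1)u+L(0)u$ and all $\operatorname{Res}_z\frac{(1+z)^{\operatorname{wt}u-1+\delta_{r,0}+r/T_g}}{z^{1+\delta_{r,0}}}Y(u,z)v$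 for homogeneous $u\in V^r$ and $v\in V$; its product is induced by $u*v=\operatorname{Res}_z\frac{(1+z)^{\operatorname{wt}u}}{z}Y(u,z)v$ for homogeneous $u\in V^0$ and $u*v=0$ for $u\in V^r$, $0<r<T_g$, and its unit is the class of $\mathbf 1$. A weak $g$-twisted module $W$ is a *lowest weight* weak $g$-twisted $(V,\omega)$-module if for some $\lambda\in\mathbb C$: $W=\bigoplus_{n\in\frac1{T_g}\mathbb N}W_{(\lambda+n)}$, where $W_{(\mu)}=\{w: L_W(0)w=\mu w\}$; $W_{(\lambda)}$ is an irreducible $A_g(V,\omega)$-module, the class of a homogeneous $v$ acting by $v_{\operatorname{wt}v-1}$; and $W_{(\lambda)}$ generates $W$ as a weak $g$-twisted module. Let $g_1,g_2,g_3$ be mutually commuting automorphisms with $g_k^T=1$ for a positive integer $T$, and let $M_k$ be a weak $g_k$-twisted module, $k=1,2,3$. An *intertwining operator* of type $\binom{M_3}{M_1\,M_2}$ for $(V,\omega)$ is a linear map $w\mapsto\mathcal Y(w,x)=\sum_{h\in\mathbb C}w_hx^{-h-1}$ from $M_1$ to $\operatorname{Hom}(M_2,M_3)\{x\}$ such that (i)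 for all $w\in M_1$, $w^{(2)}\in M_2$, $h\in\mathbb C$, $w_{h+n}w^{(2)}=0$ for $n\in\mathbb Q$ sufficiently large; (ii) for all $j_1,j_2\in\mathbb Z$, all $v\in V$ with $g_kv=e^{-2\pi i j_k/T}v$ ($k=1,2$) and all $w\in M_1$, on $M_2$, $$x_0^{-1}\left(\tfrac{x_1-x_2}{x_0}\right)^{j_1/T}\!\delta\!\left(\tfrac{x_1-x_2}{x_0}\right)Y_{M_3}(v,x_1)\mathcal Y(w,x_2)-e^{\pi i j_1/T}x_0^{-1}\left(\tfrac{x_2-x_1}{x_0}\right)^{j_1/T}\!\delta\!\left(\tfrac{x_2-x_1}{-x_0}\right)\mathcal Y(w,x_2)Y_{M_2}(v,x_1)$$ $$=x_2^{-1}\left(\tfrac{x_1-x_0}{x_2}\right)^{-j_2/T}\!\delta\!\left(\tfrac{x_1-x_0}{x_2}\right)\mathcal Y(Y_{M_1}(v,x_0)w,x_2);$$ (iii) $\mathcal Y(L_{M_1}(-1)w,x)=\frac{d}{dx}\mathcal Y(w,x)$. The space of these is $I_{(V,\omega)}\binom{M_3}{M_1\,M_2}$, and its dimension is the *fusion rule*.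 **Theorem.** Let $(V,\omega)$ and $(V,\omega')$ be two vertex operator algebra structures on the same vertex algebra $V$, and let $g_1,g_2,g_3$ be mutually commuting automorphisms of finite order of both structures. Let $W_1$ be a lowest weight weak $g_1$-twisted $(V,\omega)$-module and let $W_k$ be a weak $g_k$-twisted $V$-module for $k=2,3$. Then there is a unique $\alpha\in\mathbb C$ with $L_{W_1}(-1)-L'_{W_1}(-1)=\alpha\,\mathrm{id}_{W_1}$, and $$\mathcal Y(\cdot,x)\longmapsto e^{-\alpha x}\,\mathcal Y(\cdot,x)$$ is a linear isomorphism from $I_{(V,\omega)}\binom{W_3}{W_1\,W_2}$ onto $I_{(V,\omega')}\binom{W_3}{W_1\,W_2}$, with inverse $\mathcal Y'\mapsto e^{\alpha x}\mathcal Y'$. In particular the fusion rules of type $\binom{W_3}{W_1\,W_2}$ for $(V,\omega)$ and for $(V,\omega')$ are equal. -/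

import Mathlib

noncomputable section

/-- A vertex algebra structure on a complex vector space `V`.  Mathlib's `VertexOperator ℂ V` is the
space of linear maps from `V` to Laurent series with coefficients in `V`, so the truncation
condition "`u_n v = 0` for `n` large" is part of the type of `Y`.  The mode `u_n` is
`VertexOperator.ncoeff (Y u) n`, the coefficient of `z ^ (-n-1)`. -/
structure VertexAlgebra (V : Type*) [AddCommGroup V] [Module ℂ V] where
  /-- the vertex operator map -/
  Y : V →ₗ[ℂ] VertexOperator ℂ V
  /-- the vacuum vector -/
  vac : V
  vac_mode : ∀ n : ℤ, VertexOperator.ncoeff (Y vac) n = if n = -1 then LinearMap.id else 0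
  creation : ∀ (u : V) (n : ℤ), -1 ≤ n →
    VertexOperator.ncoeff (Y u) n vac = if n = -1 then u else 0
  /-- The Jacobi identity: equality of the coefficients of
  `z₀ ^ (-l-1) * z₁ ^ (-m-1) * z₂ ^ (-n-1)` on both sides, applied to `w`. -/
  jacobi : ∀ (u v w : V) (l m n : ℤ),
    ∑ᶠ i : ℕ, ((-1) ^ i * Ring.choose (l : ℂ) i) •
        VertexOperator.ncoeff (Y u) (m + l - i) (VertexOperator.ncoeff (Y v) (n + i) w)
      - (-1 : ℂ) ^ l • ∑ᶠ i : ℕ, ((-1) ^ i * Ring.choose (l : ℂ) i) •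
        VertexOperator.ncoeff (Y v) (n + l - i) (VertexOperator.ncoeff (Y u) (m + i) w)
      = ∑ᶠ i : ℕ, Ring.choose (m : ℂ) i •
        VertexOperator.ncoeff (Y (VertexOperator.ncoeff (Y u) (l + i) v)) (m + n - i) w

namespace VertexAlgebra

variable {V : Type*} [AddCommGroup V] [Module ℂ V] (A : VertexAlgebra V)

/-- The mode `u_n`, an endomorphism of `V`. -/
def mode (n : ℤ) (u : V) : Module.End ℂ V := VertexOperator.ncoeff (A.Y u) n

/-- The operators `L(n) = ω_{n+1}` on `V`. -/
def L (ω : V) (n : ℤ) : Module.End ℂ V := A.mode (n + 1) ω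

/-- The homogeneous subspace of conformal weight `μ`. -/
def weightSpace (ω : V) (μ : ℂ) : Submodule ℂ V := Module.End.eigenspace (A.L ω 0) μ

/-- `ω` is a conformal vector of the vertex algebra. -/
structure IsConformalVector (ω : V) : Prop where
  virasoro : ∃ c : ℂ, ∀ m n : ℤ,
    A.L ω m * A.L ω n - A.L ω n * A.L ω m =
      ((m : ℂ) - n) • A.L ω (m + n) +
        (if m + n = 0 then ((m : ℂ) ^ 3 - m) / 12 * c else 0) • (1 : Module.End ℂ V)
  L_neg_one : ∀ v : V, A.L ω (-1) v = A.mode (-2) v A.vac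
  /-- `V` is the sum (automatically direct) of the eigenspaces of `L(0)`. -/
  semisimple : ⨆ μ : ℂ, A.weightSpace ω μ = ⊤
  locally_nilpotent : ∀ n : ℤ, 1 ≤ n → ∀ v : V, ∃ k : ℕ, (A.L ω n ^ k) v = 0

/-- `(V, ω)` is a vertex operator algebra. -/
structure IsVOA (ω : V) : Prop extends A.IsConformalVector ω where
  integral_weights : ∀ μ : ℂ, A.weightSpace ω μ ≠ ⊥ → ∃ n : ℤ, μ = n
  finite_dimensional : ∀ n : ℤ, FiniteDimensional ℂ (A.weightSpace ω n)
  bounded_below : ∃ N : ℤ, ∀ n : ℤ, n < N → A.weightSpace ω n = ⊥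

/-- `g` is an automorphism of the vertex algebra. -/
structure IsAutomorphism (g : V ≃ₗ[ℂ] V) : Prop where
  map_vac : g A.vac = A.vac
  map_mode : ∀ (u v : V) (n : ℤ), g (A.mode n u v) = A.mode n (g u) (g v)

/-- `g` is an automorphism of `(V, ω)`. -/
structure IsConformalAutomorphism (ω : V) (g : V ≃ₗ[ℂ] V) : Prop
    extends A.IsAutomorphism g where
  map_conformal : g ω = ω

end VertexAlgebra

/-- `{v | g v = exp (-2 π i r / T) v}`. -/
def sector {V : Type*} [AddCommGroup V] [Module ℂ V] (g : V ≃ₗ[ℂ] V) (T : ℕ) (r : ℤ) :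
    Submodule ℂ V :=
  Module.End.eigenspace (g : V →ₗ[ℂ] V) (Complex.exp (-2 * Real.pi * Complex.I * r / T))

/-- A weak `g`-twisted module on the vector space `M`, where `g` is an automorphism of finite order
`T = orderOf g`.  The operator `mode n u` is the coefficient `u_n` of `z ^ (-n-1)` in `Y_M(u, z)`. -/
structure WeakTwistedModule {V : Type*} [AddCommGroup V] [Module ℂ V] (A : VertexAlgebra V)
    (g : V ≃ₗ[ℂ] V) (M : Type*) [AddCommGroup M] [Module ℂ M] where
  mode : ℚ → V →ₗ[ℂ] Module.End ℂ M
  /-- For `u ∈ V^r` only modes with index in `r/T + ℤ` occur. -/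
  support : ∀ r : ℕ, r < orderOf g → ∀ u ∈ sector g (orderOf g) r, ∀ n : ℚ,
    (¬ ∃ k : ℤ, n = (r : ℚ) / orderOf g + k) → mode n u = 0
  vac_mode : ∀ n : ℚ, mode n A.vac = if n = -1 then LinearMap.id else 0
  truncation : ∀ (u : V) (w : M), ∃ N : ℚ, ∀ n : ℚ, N ≤ n → mode n u w = 0
  /-- The twisted Jacobi identity for `u ∈ V^r`: equality of the coefficients of
  `z₀ ^ (-l-1) * z₁ ^ (-m-1) * z₂ ^ (-n-1)` on both sides, applied to `w`.  Both sides involve only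
  powers of `z₀` with `l ∈ ℤ` and powers of `z₁` with `m ∈ r/T + ℤ`. -/
  jacobi : ∀ r : ℕ, r < orderOf g → ∀ u ∈ sector g (orderOf g) r, ∀ (v : V) (w : M)
    (l : ℤ) (m n : ℚ), (∃ k : ℤ, m = (r : ℚ) / orderOf g + k) →
    ∑ᶠ i : ℕ, ((-1) ^ i * Ring.choose (l : ℂ) i) • mode (m + l - i) u (mode (n + i) v w)
      - (-1 : ℂ) ^ l • ∑ᶠ i : ℕ, ((-1) ^ i * Ring.choose (l : ℂ) i) •
        mode (n + l - i) v (mode (m + i) u w)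
      = ∑ᶠ i : ℕ, Ring.choose (m : ℂ) i • mode (m + n - i) (A.mode (l + i) u v) w

section Zhu

variable {V : Type*} [AddCommGroup V] [Module ℂ V] (A : VertexAlgebra V)

/-- For `u ∈ V^r` of weight `k`,
`u ∘_g v = Res_z (1+z)^(k - 1 + δ + r/T) / z^(1 + δ) Y(u,z) v`, where `δ = 1` if `r = 0`
and `δ = 0` if `0 < r < T`. -/
def zhuCirc (T : ℕ) (k : ℤ) (r : ℕ) (u v : V) : V :=
  ∑ᶠ i : ℕ, Ring.choose ((k : ℂ) - 1 + (if r = 0 then 1 else 0) + (r : ℂ) / T) i •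
    A.mode ((i : ℤ) - (if r = 0 then 1 else 0) - 1) u v

/-- For `u ∈ V^r` of weight `k`, `u *_g v = Res_z (1+z)^k / z Y(u,z) v` if `r = 0`, and
`u *_g v = 0` if `0 < r < T`. -/
def zhuMul (k : ℤ) (r : ℕ) (u v : V) : V :=
  if r = 0 then ∑ᶠ i : ℕ, Ring.choose (k : ℂ) i • A.mode ((i : ℤ) - 1) u v else 0

/-- The subspace `O_g(V, ω)`. -/
def zhuO (ω : V) (g : V ≃ₗ[ℂ] V) : Submodule ℂ V :=
  Submodule.span ℂ
    ({x | ∃ (r : ℕ) (k : ℤ) (u v : V), r < orderOf g ∧ u ∈ sector g (orderOf g) r ∧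
        u ∈ A.weightSpace ω k ∧ x = zhuCirc A (orderOf g) k r u v} ∪
     {x | ∃ u : V, x = A.L ω (-1) u + A.L ω 0 u})

/-- The underlying space of the twisted Zhu algebra, `A_g(V, ω) = V / O_g(V, ω)`. -/
abbrev ZhuAlgebra (ω : V) (g : V ≃ₗ[ℂ] V) : Type _ := V ⧸ zhuO A ω g

/-- A representation of the algebra `A_g(V, ω)`, with product induced by `*_g` and unit the class of
the vacuum, on a vector space `N`.  As `V` is spanned by the homogeneous vectors in the `V^r`, it is
enough to require multiplicativity for such a vector on the left. -/
structure IsZhuRepresentation (ω : V) (g : V ≃ₗ[ℂ] V) {N : Type*} [AddCommGroup N] [Module ℂ N]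
    (ρ : ZhuAlgebra A ω g →ₗ[ℂ] Module.End ℂ N) : Prop where
  map_one : ρ (Submodule.Quotient.mk A.vac) = 1
  map_mul : ∀ (r : ℕ) (k : ℤ) (u v : V), r < orderOf g → u ∈ sector g (orderOf g) r →
    u ∈ A.weightSpace ω k →
    ρ (Submodule.Quotient.mk (zhuMul A k r u v)) =
      ρ (Submodule.Quotient.mk u) * ρ (Submodule.Quotient.mk v)

/-- The representation `ρ` is irreducible: nonzero, without proper nonzero invariant subspaces. -/
def IsIrreducibleZhu (ω : V) (g : V ≃ₗ[ℂ] V) {N : Type*} [AddCommGroup N] [Module ℂ N]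
    (ρ : ZhuAlgebra A ω g →ₗ[ℂ] Module.End ℂ N) : Prop :=
  Nontrivial N ∧
    ∀ U : Submodule ℂ N, (∀ x, ∀ w ∈ U, ρ x w ∈ U) → U = ⊥ ∨ U = ⊤

end Zhu

namespace WeakTwistedModule

variable {V : Type*} [AddCommGroup V] [Module ℂ V] {A : VertexAlgebra V} {g : V ≃ₗ[ℂ] V}
  {M : Type*} [AddCommGroup M] [Module ℂ M] (W : WeakTwistedModule A g M)

/-- `L_W(n) = ω_{n+1}` acting on the module. -/
def L (ω : V) (n : ℤ) : Module.End ℂ M := W.mode ((n : ℚ) + 1) ω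

/-- The eigenspace of `L_W(0)` with eigenvalue `μ`. -/
def weightSpace (ω : V) (μ : ℂ) : Submodule ℂ M := Module.End.eigenspace (W.L ω 0) μ

/-- `W` is a lowest weight weak `g`-twisted `(V, ω)`-module with lowest weight `μ`. -/
structure IsLowestWeightWith (ω : V) (μ : ℂ) : Prop where
  /-- `W` is the sum (automatically direct) of the `W_(μ + n)`, `n ∈ (1/T) ℕ`. -/
  decomposition : ⨆ k : ℕ, W.weightSpace ω (μ + (k : ℂ) / orderOf g) = ⊤
  /-- `W_(μ)` is an irreducible `A_g(V, ω)`-module, on which the class of a homogeneous `v` acts by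
  `o(v) = v_{wt v - 1}`. -/
  irreducible : ∃ ρ : ZhuAlgebra A ω g →ₗ[ℂ] Module.End ℂ (W.weightSpace ω μ),
    (∀ (k : ℤ), ∀ v ∈ A.weightSpace ω k, ∀ w : W.weightSpace ω μ,
      (ρ (Submodule.Quotient.mk v) w : M) = W.mode ((k : ℚ) - 1) v w) ∧
    IsZhuRepresentation A ω g ρ ∧ IsIrreducibleZhu A ω g ρ
  /-- `W_(μ)` generates `W` as a weak `g`-twisted module. -/
  generates : ∀ U : Submodule ℂ M, W.weightSpace ω μ ≤ U →
    (∀ (n : ℚ) (v : V), ∀ w ∈ U, W.mode n v w ∈ U) → U = ⊤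

/-- `W` is a lowest weight weak `g`-twisted `(V, ω)`-module. -/
def IsLowestWeight (ω : V) : Prop := ∃ μ : ℂ, W.IsLowestWeightWith ω μ

end WeakTwistedModule

section Intertwining

variable {V : Type*} [AddCommGroup V] [Module ℂ V] {A : VertexAlgebra V}
  {g₁ g₂ g₃ : V ≃ₗ[ℂ] V}
  {M₁ M₂ M₃ : Type*} [AddCommGroup M₁] [Module ℂ M₁] [AddCommGroup M₂] [Module ℂ M₂]
  [AddCommGroup M₃] [Module ℂ M₃]
  (W₁ : WeakTwistedModule A g₁ M₁) (W₂ : WeakTwistedModule A g₂ M₂)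
  (W₃ : WeakTwistedModule A g₃ M₃)

/-- Linear maps `M₁ → Hom(M₂, M₃){x}`, `w ↦ ∑_{h ∈ ℂ} w_h x ^ (-h-1)`; the value at `h` is
`w ↦ w_h`. -/
abbrev FormalOperator (M₁ M₂ M₃ : Type*) [AddCommGroup M₁] [Module ℂ M₁] [AddCommGroup M₂]
    [Module ℂ M₂] [AddCommGroup M₃] [Module ℂ M₃] : Type _ :=
  ℂ → M₁ →ₗ[ℂ] M₂ →ₗ[ℂ] M₃

/-- The coefficient of `x₁ ^ (-m-1) * x₂ ^ (-n-1)` in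
`(x₁ - x₂) ^ l * Y₃(v, x₁) * 𝒴(w₁, x₂) w₂`, expanded in nonnegative powers of `x₂`. -/
def jacobiFst (F : FormalOperator M₁ M₂ M₃) (v : V) (w₁ : M₁) (w₂ : M₂) (l m : ℚ) (n : ℂ) : M₃ :=
  ∑ᶠ i : ℕ, ((-1) ^ i * Ring.choose (l : ℂ) i) • W₃.mode (m + l - i) v (F (n + i) w₁ w₂)

/-- The coefficient of `x₁ ^ (-m-1) * x₂ ^ (-n-1)` in
`(x₂ - x₁) ^ l * 𝒴(w₁, x₂) * Y₂(v, x₁) w₂`, expanded in nonnegative powers of `x₁`. -/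
def jacobiSnd (F : FormalOperator M₁ M₂ M₃) (v : V) (w₁ : M₁) (w₂ : M₂) (l m : ℚ) (n : ℂ) : M₃ :=
  ∑ᶠ i : ℕ, ((-1) ^ i * Ring.choose (l : ℂ) i) • F (n + l - i) w₁ (W₂.mode (m + i) v w₂)

/-- For `m ∈ s + ℤ`, the coefficient of `x₀ ^ (-l-1) * x₁ ^ (-m-1) * x₂ ^ (-n-1)` in
`x₂⁻¹ ((x₁ - x₀)/x₂) ^ (-s) δ((x₁ - x₀)/x₂) 𝒴(Y₁(v, x₀) w₁, x₂) w₂`.  Here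
`(-1)^i * choose (i-m-1) i = choose m i` has been used. -/
def jacobiTrd (F : FormalOperator M₁ M₂ M₃) (v : V) (w₁ : M₁) (w₂ : M₂) (l m : ℚ) (n : ℂ) : M₃ :=
  ∑ᶠ i : ℕ, Ring.choose (m : ℂ) i • F (m + n - i) (W₁.mode (l + i) v w₁) w₂

/-- `F` is an intertwining operator of type `(W₃; W₁ W₂)` for `(V, ω)`; here
`g₁ ^ T = g₂ ^ T = g₃ ^ T = 1`. -/
structure IsIntertwining (ω : V) (T : ℕ) (F : FormalOperator M₁ M₂ M₃) : Prop where
  truncation : ∀ (w₁ : M₁) (w₂ : M₂) (h : ℂ), ∃ N : ℚ, ∀ n : ℚ, N ≤ n → F (h + n) w₁ w₂ = 0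
  /-- The Jacobi identity for `v ∈ V^(j₁, j₂)`: equality of the coefficients of
  `x₀ ^ (-l-1) * x₁ ^ (-m-1) * x₂ ^ (-n-1)`, with `l = j₁/T + p`, `p ∈ ℤ` (no other powers of `x₀`
  occur).  The right-hand side only has powers of `x₁` with `m ∈ j₂/T + ℤ`. -/
  jacobi : ∀ (j₁ j₂ : ℤ), ∀ v ∈ sector g₁ T j₁ ⊓ sector g₂ T j₂, ∀ (w₁ : M₁) (w₂ : M₂)
    (p : ℤ) (m : ℚ) (n : ℂ), (∃ q : ℤ, m = (j₂ : ℚ) / T + q) →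
    jacobiFst W₃ F v w₁ w₂ ((j₁ : ℚ) / T + p) m n
      - (Complex.exp ((j₁ : ℂ) / T * Real.pi * Complex.I) * (-1 : ℂ) ^ p) •
        jacobiSnd W₂ F v w₁ w₂ ((j₁ : ℚ) / T + p) m n
      = jacobiTrd W₁ F v w₁ w₂ ((j₁ : ℚ) / T + p) m n
  /-- The remaining coefficients of the Jacobi identity, `m ∉ j₂/T + ℤ`. -/
  jacobi_vanish : ∀ (j₁ j₂ : ℤ), ∀ v ∈ sector g₁ T j₁ ⊓ sector g₂ T j₂, ∀ (w₁ : M₁) (w₂ : M₂)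
    (p : ℤ) (m : ℚ) (n : ℂ), (¬ ∃ q : ℤ, m = (j₂ : ℚ) / T + q) →
    jacobiFst W₃ F v w₁ w₂ ((j₁ : ℚ) / T + p) m n
      - (Complex.exp ((j₁ : ℂ) / T * Real.pi * Complex.I) * (-1 : ℂ) ^ p) •
        jacobiSnd W₂ F v w₁ w₂ ((j₁ : ℚ) / T + p) m n
      = 0
  /-- `𝒴(L(-1) w, x) = d/dx 𝒴(w, x)`: the coefficient of `x ^ (-h-1)`. -/
  derivative : ∀ (w₁ : M₁) (h : ℂ), F h (W₁.L ω (-1) w₁) = -h • F (h - 1) w₁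

section Lemmas

variable {W₁ W₂ W₃}

theorem hasFiniteSupport_of_eventually {N : Type*} [AddCommGroup N] (f : ℕ → N) (B : ℚ)
    (hf : ∀ i : ℕ, B ≤ i → f i = 0) : Function.HasFiniteSupport f := by
  refine (Set.finite_Iio ⌈B⌉₊).subset fun i hi => ?_
  by_contra h
  exact hi (hf i (Nat.ceil_le.mp (not_lt.mp h)))

theorem jacobiFst_add {F G : FormalOperator M₁ M₂ M₃}
    (hF : ∀ (w₁ : M₁) (w₂ : M₂) (h : ℂ), ∃ N : ℚ, ∀ n : ℚ, N ≤ n → F (h + n) w₁ w₂ = 0)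
    (hG : ∀ (w₁ : M₁) (w₂ : M₂) (h : ℂ), ∃ N : ℚ, ∀ n : ℚ, N ≤ n → G (h + n) w₁ w₂ = 0)
    (v : V) (w₁ : M₁) (w₂ : M₂) (l m : ℚ) (n : ℂ) :
    jacobiFst W₃ (F + G) v w₁ w₂ l m n =
      jacobiFst W₃ F v w₁ w₂ l m n + jacobiFst W₃ G v w₁ w₂ l m n := by
  unfold jacobiFst
  rw [← finsum_add_distrib]
  · simp
  · obtain ⟨N, hN⟩ := hF w₁ w₂ n
    refine hasFiniteSupport_of_eventually _ N fun i hi => ?_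
    have := hN i hi
    simp only [Rat.cast_natCast] at this
    simp [this]
  · obtain ⟨N, hN⟩ := hG w₁ w₂ n
    refine hasFiniteSupport_of_eventually _ N fun i hi => ?_
    have := hN i hi
    simp only [Rat.cast_natCast] at this
    simp [this]

theorem jacobiSnd_add (F G : FormalOperator M₁ M₂ M₃)
    (v : V) (w₁ : M₁) (w₂ : M₂) (l m : ℚ) (n : ℂ) :
    jacobiSnd W₂ (F + G) v w₁ w₂ l m n =
      jacobiSnd W₂ F v w₁ w₂ l m n + jacobiSnd W₂ G v w₁ w₂ l m n := by
  unfold jacobiSnd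
  obtain ⟨N, hN⟩ := W₂.truncation v w₂
  rw [← finsum_add_distrib]
  · simp
  all_goals
    refine hasFiniteSupport_of_eventually _ (N - m) fun i hi => ?_
    have := hN (m + i) (by linarith)
    simp [this]

theorem jacobiTrd_add (F G : FormalOperator M₁ M₂ M₃)
    (v : V) (w₁ : M₁) (w₂ : M₂) (l m : ℚ) (n : ℂ) :
    jacobiTrd W₁ (F + G) v w₁ w₂ l m n =
      jacobiTrd W₁ F v w₁ w₂ l m n + jacobiTrd W₁ G v w₁ w₂ l m n := by
  unfold jacobiTrd
  obtain ⟨N, hN⟩ := W₁.truncation v w₁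
  rw [← finsum_add_distrib]
  · simp
  all_goals
    refine hasFiniteSupport_of_eventually _ (N - l) fun i hi => ?_
    have := hN (l + i) (by linarith)
    simp [this]

theorem jacobiFst_smul (c : ℂ) (F : FormalOperator M₁ M₂ M₃)
    (v : V) (w₁ : M₁) (w₂ : M₂) (l m : ℚ) (n : ℂ) :
    jacobiFst W₃ (c • F) v w₁ w₂ l m n = c • jacobiFst W₃ F v w₁ w₂ l m n := by
  unfold jacobiFst
  rw [smul_finsum]
  exact finsum_congr fun i => by simp [smul_comm c]

theorem jacobiSnd_smul (c : ℂ) (F : FormalOperator M₁ M₂ M₃)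
    (v : V) (w₁ : M₁) (w₂ : M₂) (l m : ℚ) (n : ℂ) :
    jacobiSnd W₂ (c • F) v w₁ w₂ l m n = c • jacobiSnd W₂ F v w₁ w₂ l m n := by
  unfold jacobiSnd
  rw [smul_finsum]
  exact finsum_congr fun i => by simp [smul_comm c]

theorem jacobiTrd_smul (c : ℂ) (F : FormalOperator M₁ M₂ M₃)
    (v : V) (w₁ : M₁) (w₂ : M₂) (l m : ℚ) (n : ℂ) :
    jacobiTrd W₁ (c • F) v w₁ w₂ l m n = c • jacobiTrd W₁ F v w₁ w₂ l m n := by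
  unfold jacobiTrd
  rw [smul_finsum]
  exact finsum_congr fun i => by simp [smul_comm c]

theorem IsIntertwining.add {ω : V} {T : ℕ} {F G : FormalOperator M₁ M₂ M₃}
    (hF : IsIntertwining W₁ W₂ W₃ ω T F) (hG : IsIntertwining W₁ W₂ W₃ ω T G) :
    IsIntertwining W₁ W₂ W₃ ω T (F + G) where
  truncation w₁ w₂ h := by
    obtain ⟨N, hN⟩ := hF.truncation w₁ w₂ h
    obtain ⟨N', hN'⟩ := hG.truncation w₁ w₂ h
    refine ⟨max N N', fun n hn => ?_⟩
    simp [hN n ((le_max_left _ _).trans hn), hN' n ((le_max_right _ _).trans hn)]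
  jacobi j₁ j₂ v hv w₁ w₂ p m n hm := by
    rw [jacobiFst_add hF.truncation hG.truncation, jacobiSnd_add, jacobiTrd_add,
      ← hF.jacobi j₁ j₂ v hv w₁ w₂ p m n hm, ← hG.jacobi j₁ j₂ v hv w₁ w₂ p m n hm, smul_add]
    abel
  jacobi_vanish j₁ j₂ v hv w₁ w₂ p m n hm := by
    rw [jacobiFst_add hF.truncation hG.truncation, jacobiSnd_add, smul_add, add_sub_add_comm,
      hF.jacobi_vanish j₁ j₂ v hv w₁ w₂ p m n hm, hG.jacobi_vanish j₁ j₂ v hv w₁ w₂ p m n hm,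
      add_zero]
  derivative w₁ h := by
    simp only [Pi.add_apply, LinearMap.add_apply, hF.derivative, hG.derivative, smul_add]

theorem IsIntertwining.smul {ω : V} {T : ℕ} {F : FormalOperator M₁ M₂ M₃} (c : ℂ)
    (hF : IsIntertwining W₁ W₂ W₃ ω T F) : IsIntertwining W₁ W₂ W₃ ω T (c • F) where
  truncation w₁ w₂ h := by
    obtain ⟨N, hN⟩ := hF.truncation w₁ w₂ h
    exact ⟨N, fun n hn => by simp [hN n hn]⟩
  jacobi j₁ j₂ v hv w₁ w₂ p m n hm := by
    rw [jacobiFst_smul, jacobiSnd_smul, jacobiTrd_smul,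
      ← hF.jacobi j₁ j₂ v hv w₁ w₂ p m n hm, smul_comm _ c, smul_sub]
  jacobi_vanish j₁ j₂ v hv w₁ w₂ p m n hm := by
    rw [jacobiFst_smul, jacobiSnd_smul, smul_comm _ c, ← smul_sub,
      hF.jacobi_vanish j₁ j₂ v hv w₁ w₂ p m n hm, smul_zero]
  derivative w₁ h := by
    simp only [Pi.smul_apply, LinearMap.smul_apply, hF.derivative, smul_comm c]

variable (W₁ W₂ W₃) in
theorem IsIntertwining.zero (ω : V) (T : ℕ) :
    IsIntertwining W₁ W₂ W₃ ω T (0 : FormalOperator M₁ M₂ M₃) where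
  truncation _ _ _ := ⟨0, fun _ _ => by simp⟩
  jacobi _ _ _ _ _ _ _ _ _ _ := by simp [jacobiFst, jacobiSnd, jacobiTrd]
  jacobi_vanish _ _ _ _ _ _ _ _ _ _ := by simp [jacobiFst, jacobiSnd]
  derivative _ _ := by simp

end Lemmas

/-- The space of intertwining operators of type `(W₃; W₁ W₂)` for `(V, ω)`. -/
def intertwiningSpace (ω : V) (T : ℕ) : Submodule ℂ (FormalOperator M₁ M₂ M₃) where
  carrier := {F | IsIntertwining W₁ W₂ W₃ ω T F}
  add_mem' hF hG := hF.add hG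
  zero_mem' := IsIntertwining.zero W₁ W₂ W₃ ω T
  smul_mem' c _ hF := hF.smul c

/-- The fusion rule: the dimension of the space of intertwining operators. -/
def fusionRule (ω : V) (T : ℕ) : Cardinal := Module.rank ℂ (intertwiningSpace W₁ W₂ W₃ ω T)

/-- The coefficient of `x ^ (-h-1)` in `e ^ (β x) 𝒴(w₁, x) w₂`.  The sum is finite as soon as
`𝒴(w₁, x) w₂` is truncated. -/
def expMulCoeff (β : ℂ) (F : FormalOperator M₁ M₂ M₃) (h : ℂ) (w₁ : M₁) (w₂ : M₂) : M₃ :=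
  ∑ᶠ k : ℕ, (β ^ k / (k.factorial : ℂ)) • F (h + k) w₁ w₂

end Intertwining

end

/-! Put `a = ω - ω'`. On `V` both `ω_0` and `ω'_0` are `v ↦ v_{-2} 1`, so `a_0 = 0` there. The
twisted commutator formula reads `[a_0, v_n] = (a_0 v)_n`, so on `W₁` the operator `a_0 = L(-1) -
L'(-1)` commutes with every mode (`mode_zero_commute`). It therefore preserves the lowest weight
space and commutes with the irreducible action of the Zhu algebra. As `V` has countable dimension,
so does that space, and Dixmier's lemma (`exists_eq_smul_of_commute_irreducible`) makes `a_0` a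
scalar `α` on it. The `α`-eigenspace of `a_0` is closed under all modes and contains the generating
subspace, so `a_0 = α` on all of `W₁`.

The conformal vector enters the definition of an intertwining operator only through the
`L(-1)`-derivative property. Multiplication by `e^{βx}` respects the Jacobi identity, since it
multiplies all three terms by the same series in `x₂`; it changes the derivative by `β`. With `β =
-α` this is exactly the passage from `L(-1)` to `L'(-1) = L(-1) - α` (`IsIntertwining.expMul`), and
`e^{-βx}` undoes it. -/

/-! ### Dixmier's lemma in countable dimension. -/

section Dixmier

open Polynomial

/-- An endomorphism without eigenvalues over an algebraically closed field: nonzero polynomials in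
it are injective. -/
theorem aeval_injective_of_sub_injective {K N : Type*} [Field K] [IsAlgClosed K] [AddCommGroup N]
    [Module K N] (f : Module.End K N)
    (hf : ∀ c : K, Function.Injective (f - algebraMap K (Module.End K N) c))
    {p : K[X]} (hp : p ≠ 0) : Function.Injective (aeval f p) := by
  have key : ∀ s : Multiset K,
      Function.Injective (aeval f (s.map fun a => X - C a).prod) := by
    intro s
    induction s using Multiset.induction_on with
    | empty =>
      intro x y hxy
      simpa using hxy
    | cons a s ih =>
      rw [Multiset.map_cons, Multiset.prod_cons, map_mul, Module.End.mul_eq_comp,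
        LinearMap.coe_comp]
      refine Function.Injective.comp ?_ ih
      simpa using hf a
  rw [(IsAlgClosed.splits p).eq_prod_roots, map_mul, aeval_C, Module.End.mul_eq_comp,
    LinearMap.coe_comp]
  refine Function.Injective.comp ?_ (key _)
  intro x y hxy
  simpa [Module.algebraMap_end_apply, hp] using hxy

/-- If every `f - c` is bijective, preimages of a nonzero vector under the `f - c` are linearly
independent. -/
theorem linearIndependent_resolvent {K N : Type*} [Field K] [IsAlgClosed K] [AddCommGroup N]
    [Module K N] (f : Module.End K N)
    (hf : ∀ c : K, Function.Injective (f - algebraMap K (Module.End K N) c))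
    {w : N} (hw : w ≠ 0) (u : K → N)
    (hu : ∀ c, (f - algebraMap K (Module.End K N) c) (u c) = w) : LinearIndependent K u := by
  classical
  rw [linearIndependent_iff']
  intro s a ha c hc
  -- `u d` plays the role of `(f - d)⁻¹ w`; `q` is `∑ a d / (X - d)` with denominators cleared, so a
  -- linear relation among the `u d` gives `q(f) w = 0`.
  let q : K[X] := ∑ d ∈ s, C (a d) * ∏ e ∈ s.erase d, (X - C e)
  have hq : aeval f q w = 0 := by
    have h1 : ∀ d ∈ s, aeval f (C (a d) * ∏ e ∈ s.erase d, (X - C e)) w =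
        aeval f (∏ e ∈ s, (X - C e)) (a d • u d) := by
      intro d hd
      rw [← Finset.prod_erase_mul s _ hd, map_mul, map_mul, aeval_C, Module.End.mul_apply,
        Module.End.mul_apply, map_smul, Module.algebraMap_end_apply, map_smul]
      rw [map_sub, aeval_X, aeval_C, hu]
    simp only [q, map_sum, LinearMap.sum_apply]
    rw [Finset.sum_congr rfl h1, ← map_sum, ha, map_zero]
  have hq0 : q = 0 := by
    by_contra h
    exact hw (aeval_injective_of_sub_injective f hf h (by rw [hq, map_zero]))
  -- At `X = c` every summand but the one of index `c` contains the factor `c - c`.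
  have h2 : q.eval c = a c * ∏ e ∈ s.erase c, (c - e) := by
    simp only [q, eval_finsetSum, eval_mul, eval_C, eval_prod, eval_sub, eval_X]
    refine Finset.sum_eq_single_of_mem c hc fun d _ hdc => ?_
    rw [Finset.prod_eq_zero (Finset.mem_erase.2 ⟨hdc.symm, hc⟩) (sub_self c), mul_zero]
  rw [hq0, eval_zero] at h2
  refine (mul_eq_zero.1 h2.symm).resolve_right ?_
  refine Finset.prod_ne_zero_iff.2 fun e he => sub_ne_zero.2 (Finset.ne_of_mem_erase he).symm

/-- **Dixmier's lemma**: an endomorphism commuting with an irreducible family of operators on a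
complex vector space of countable dimension is a scalar. -/
theorem exists_eq_smul_of_commute_irreducible {X N : Type*} [AddCommGroup N] [Module ℂ N]
    [Nontrivial N] (ρ : X → Module.End ℂ N)
    (hρ : ∀ U : Submodule ℂ N, (∀ x, ∀ w ∈ U, ρ x w ∈ U) → U = ⊥ ∨ U = ⊤)
    (hN : ∃ s : Set N, s.Countable ∧ Submodule.span ℂ s = ⊤)
    (f : Module.End ℂ N) (hf : ∀ x w, f (ρ x w) = ρ x (f w)) :
    ∃ c : ℂ, ∀ w, f w = c • w := by
  by_contra! hne
  let F : ℂ → Module.End ℂ N := fun c => f - algebraMap ℂ (Module.End ℂ N) c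
  have hF : ∀ c x w, F c (ρ x w) = ρ x (F c w) := fun c x w => by
    simp [F, hf, Module.algebraMap_end_apply]
  have hker : ∀ c, LinearMap.ker (F c) = ⊥ := by
    intro c
    refine (hρ _ fun x w hw => ?_).resolve_right fun h => ?_
    · rw [LinearMap.mem_ker] at hw ⊢
      rw [hF, hw, map_zero]
    · obtain ⟨w, hw⟩ := hne c
      have : F c w = 0 := LinearMap.mem_ker.1 (h ▸ Submodule.mem_top)
      exact hw (sub_eq_zero.1 (by simpa [F, Module.algebraMap_end_apply] using this))
  have hrange : ∀ c, LinearMap.range (F c) = ⊤ := by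
    intro c
    refine (hρ _ ?_).resolve_left fun h => ?_
    · rintro x _ ⟨w, rfl⟩
      exact ⟨ρ x w, hF c x w⟩
    · obtain ⟨w, hw⟩ := hne c
      have : F c w = 0 := by
        have hm : F c w ∈ LinearMap.range (F c) := ⟨w, rfl⟩
        rwa [h, Submodule.mem_bot] at hm
      exact hw (sub_eq_zero.1 (by simpa [F, Module.algebraMap_end_apply] using this))
  obtain ⟨w, hw⟩ := exists_ne (0 : N)
  -- If `f` is no scalar, all `f - c` are bijective, and the vectors `(f - c)⁻¹ w` form an
  -- independent family indexed by `ℂ`: too many for countable dimension.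
  choose u hu using fun c => LinearMap.range_eq_top.1 (hrange c) w
  have hli := linearIndependent_resolvent f (fun c => LinearMap.ker_eq_bot.1 (hker c)) hw u hu
  obtain ⟨s, hs, hspan⟩ := hN
  have h1 : Module.rank ℂ N ≤ Cardinal.aleph0 := by
    rw [← rank_top ℂ N, ← hspan]
    exact (rank_span_le s).trans hs.le_aleph0
  have h2 := hli.cardinal_lift_le_rank
  rw [Cardinal.mk_complex, Cardinal.lift_continuum] at h2
  have h3 := h2.trans (Cardinal.lift_le.2 h1)
  rw [Cardinal.lift_aleph0] at h3
  exact absurd h3 (not_le.2 Cardinal.aleph0_lt_continuum)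

/-- A space on which a countable set of operators acts irreducibly has countable dimension. -/
theorem exists_countable_span_eq_top_of_irreducible {V N : Type*} [AddCommGroup V] [Module ℂ V]
    [AddCommGroup N] [Module ℂ N] [Nontrivial N] (ρ : V →ₗ[ℂ] Module.End ℂ N)
    (hρ : ∀ U : Submodule ℂ N, (∀ x, ∀ w ∈ U, ρ x w ∈ U) → U = ⊥ ∨ U = ⊤)
    (hV : ∃ s : Set V, s.Countable ∧ Submodule.span ℂ s = ⊤) :
    ∃ s : Set N, s.Countable ∧ Submodule.span ℂ s = ⊤ := by
  obtain ⟨s, hs, hspan⟩ := hV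
  obtain ⟨w, hw⟩ := exists_ne (0 : N)
  have := hs.to_subtype
  -- Words in the countably many operators `ρ x`, `x ∈ s`, applied to one nonzero vector; their span
  -- is invariant, first under `ρ x` for `x ∈ s`, then for all `x` by linearity.
  let t : List s → N := fun l => (l.map fun x => ρ x).prod w
  refine ⟨Set.range t, Set.countable_range t, (hρ _ fun x y hy => ?_).resolve_left fun h => ?_⟩
  · have hx : x ∈ Submodule.span ℂ s := hspan ▸ Submodule.mem_top
    induction hx using Submodule.span_induction with
    | mem x hx =>
      refine (Submodule.span_le (p := (Submodule.span ℂ (Set.range t)).comap (ρ x))).2 ?_ hy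
      rintro _ ⟨l, rfl⟩
      exact Submodule.subset_span ⟨⟨x, hx⟩ :: l, by simp [t]⟩
    | zero => simp
    | add a b _ _ ha hb => simpa using add_mem ha hb
    | smul c a _ ha => simpa using Submodule.smul_mem _ c ha
  · have : w ∈ Submodule.span ℂ (Set.range t) := Submodule.subset_span ⟨[], by simp [t]⟩
    rw [h, Submodule.mem_bot] at this
    exact hw this

end Dixmier

/-! ### The difference of the two `L(-1)` operators is a scalar. -/

section LowestWeight

variable {V : Type*} [AddCommGroup V] [Module ℂ V] {A : VertexAlgebra V}

namespace VertexAlgebra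

theorem IsVOA.iSup_weightSpace_int {ω : V} (hω : A.IsVOA ω) :
    ⨆ n : ℤ, A.weightSpace ω n = ⊤ := by
  rw [eq_top_iff, ← hω.semisimple]
  refine iSup_le fun μ => ?_
  by_cases h : A.weightSpace ω μ = ⊥
  · simp [h]
  · obtain ⟨n, rfl⟩ := hω.integral_weights μ h
    exact le_iSup (fun n : ℤ => A.weightSpace ω n) n

theorem IsVOA.exists_countable_span_eq_top {ω : V} (hω : A.IsVOA ω) :
    ∃ s : Set V, s.Countable ∧ Submodule.span ℂ s = ⊤ := by
  have : ∀ n : ℤ, ∃ s : Set V, s.Finite ∧ Submodule.span ℂ s = A.weightSpace ω n := by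
    intro n
    have := hω.finite_dimensional n
    exact Submodule.fg_def.1 (Module.Finite.iff_fg.1 this)
  choose s hs hspan using this
  refine ⟨⋃ n, s n, Set.countable_iUnion fun n => (hs n).countable, ?_⟩
  rw [Submodule.span_iUnion, ← hω.iSup_weightSpace_int]
  exact iSup_congr hspan

end VertexAlgebra

namespace WeakTwistedModule

variable {g : V ≃ₗ[ℂ] V} {M : Type*} [AddCommGroup M] [Module ℂ M] (W : WeakTwistedModule A g M)

/-- The zero mode of a `g`-invariant vector `a` with `a_0 = 0` on `V` commutes with all modes. -/
theorem mode_zero_commute (hg : IsOfFinOrder g) {a : V} (ha : g a = a) (ha0 : A.mode 0 a = 0)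
    (n : ℚ) (v : V) (w : M) : W.mode 0 a (W.mode n v w) = W.mode n v (W.mode 0 a w) := by
  have hsec : a ∈ sector g (orderOf g) ((0 : ℕ) : ℤ) := by
    simp [sector, ha]
  -- With `l = m = 0` each sum reduces to its term `i = 0`, leaving `a_0 v_n w - v_n a_0 w = (a_0
  -- v)_n w`. The index `m = 0` is admissible because `a` lies in `V^0`.
  have h := W.jacobi 0 hg.orderOf_pos a hsec v w 0 0 n ⟨0, by simp⟩
  have hc : ∀ i : ℕ, i ≠ 0 → Ring.choose (0 : ℂ) i = 0 := fun i hi =>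
    Ring.choose_zero_pos ℂ (Nat.pos_of_ne_zero hi)
  rw [finsum_eq_single _ 0 fun i hi => by simp [hc i hi],
    finsum_eq_single _ 0 fun i hi => by simp [hc i hi],
    finsum_eq_single _ 0 fun i hi => by simp [hc i hi]] at h
  simpa [ha0, sub_eq_zero] using h

variable {W}

/-- An operator on a lowest weight module commuting with all modes is a scalar. -/
theorem IsLowestWeight.exists_eq_smul {ω : V} (hω : A.IsVOA ω) (hW : W.IsLowestWeight ω)
    (f : Module.End ℂ M) (hf : ∀ n v w, f (W.mode n v w) = W.mode n v (f w)) :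
    ∃ c : ℂ, ∀ w, f w = c • w := by
  obtain ⟨μ, -, ⟨ρ, hact, -, hnt, hirr⟩, hgen⟩ := hW
  -- `L(0) = ω_1` is itself a mode, so `f` commutes with it.
  have hinv : ∀ w ∈ W.weightSpace ω μ, f w ∈ W.weightSpace ω μ := by
    intro w hw
    rw [weightSpace, Module.End.mem_eigenspace_iff] at hw ⊢
    rw [L, ← hf, ← L, hw, map_smul]
  let ρ' : V →ₗ[ℂ] Module.End ℂ (W.weightSpace ω μ) := ρ ∘ₗ (zhuO A ω g).mkQ
  have hirr' : ∀ U : Submodule ℂ (W.weightSpace ω μ),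
      (∀ x, ∀ w ∈ U, ρ' x w ∈ U) → U = ⊥ ∨ U = ⊤ := by
    refine fun U hU => hirr U fun x => ?_
    obtain ⟨v, rfl⟩ := Submodule.mkQ_surjective _ x
    exact hU v
  obtain ⟨c, hc⟩ := exists_eq_smul_of_commute_irreducible ρ' hirr'
    (exists_countable_span_eq_top_of_irreducible ρ' hirr' hω.exists_countable_span_eq_top)
    (f.restrict hinv) (by
      intro v w
      -- The action is given by modes only on homogeneous vectors; these span `V`.
      have hv : v ∈ ⨆ n : ℤ, A.weightSpace ω n := hω.iSup_weightSpace_int ▸ Submodule.mem_top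
      induction hv using Submodule.iSup_induction' with
      | mem n v hv =>
        apply Subtype.ext
        have h1 := hact n v hv
        change f (ρ (Submodule.Quotient.mk v) w : M) =
          (ρ (Submodule.Quotient.mk v) (f.restrict hinv w) : M)
        rw [h1, h1, hf]
        rfl
      | zero => simp
      | add a b _ _ ha hb => simp only [map_add, LinearMap.add_apply, ha, hb])
  refine ⟨c, fun w => ?_⟩
  -- The eigenspace is closed under all modes and contains the generating lowest weight space.
  have htop : Module.End.eigenspace f c = ⊤ := by
    refine hgen _ (fun w hw => ?_) fun n v w hw => ?_
    · rw [Module.End.mem_eigenspace_iff]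
      exact congrArg Subtype.val (hc ⟨w, hw⟩)
    · rw [Module.End.mem_eigenspace_iff] at hw ⊢
      rw [hf, hw, map_smul]
  exact Module.End.mem_eigenspace_iff.1 (htop ▸ Submodule.mem_top)

theorem IsLowestWeight.nontrivial {ω : V} (hW : W.IsLowestWeight ω) : Nontrivial M := by
  obtain ⟨μ, -, ⟨ρ, -, -, hnt, -⟩, -⟩ := hW
  exact (W.weightSpace ω μ).subtype_injective.nontrivial

theorem IsLowestWeight.existsUnique_L_neg_one_sub {ω ω' : V} (hω : A.IsVOA ω) (hω' : A.IsVOA ω')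
    (hg : IsOfFinOrder g) (hgω : g ω = ω) (hgω' : g ω' = ω') (hW : W.IsLowestWeight ω) :
    ∃! α : ℂ, ∀ w : M, W.L ω (-1) w - W.L ω' (-1) w = α • w := by
  have hL : ∀ w, W.L ω (-1) w - W.L ω' (-1) w = W.mode 0 (ω - ω') w := by
    intro w
    simp [L]
  have h0 : A.mode 0 (ω - ω') = 0 := by
    ext v
    have h1 := hω.L_neg_one v
    rw [← hω'.L_neg_one v] at h1
    simp only [VertexAlgebra.L, VertexAlgebra.mode, neg_add_cancel] at h1
    simp [VertexAlgebra.mode, h1]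
  obtain ⟨α, hα⟩ := hW.exists_eq_smul hω (W.mode 0 (ω - ω'))
    (W.mode_zero_commute hg (by simp [hgω, hgω']) h0)
  have := hW.nontrivial
  obtain ⟨w, hw⟩ := exists_ne (0 : M)
  refine ⟨α, fun w => (hL w).trans (hα w), fun β hβ => ?_⟩
  exact smul_left_injective ℂ hw (by simp only; rw [← hβ w, hL, hα])

end WeakTwistedModule

end LowestWeight

/-! ### Finite sums and multiplication by `e^{βx}`. -/

section ExpMul

theorem finsum_eq_sum_range {N : Type*} [AddCommMonoid N] {f : ℕ → N} {B : ℕ}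
    (hf : ∀ i, B ≤ i → f i = 0) : ∑ᶠ i, f i = ∑ i ∈ Finset.range B, f i := by
  refine finsum_eq_sum_of_support_subset _ fun i hi => ?_
  by_contra h
  exact hi (hf i (by simpa using h))

/-- The support lies in a finite rectangle. This exchanges the sum over powers of `βx` with the sums
in the Jacobi identity. -/
theorem finsum_comm_of_bounded {N : Type*} [AddCommMonoid N] {f : ℕ → ℕ → N} {B C : ℕ}
    (hB : ∀ i k, B ≤ i → f i k = 0) (hC : ∀ i k, C ≤ k → f i k = 0) :
    ∑ᶠ i, ∑ᶠ k, f i k = ∑ᶠ k, ∑ᶠ i, f i k := by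
  rw [finsum_eq_sum_range (B := B) fun i hi => by simp [hB i _ hi],
    finsum_eq_sum_range (B := C) fun k hk => by simp [hC _ k hk]]
  simp_rw [fun i => finsum_eq_sum_range (hC i), fun k => finsum_eq_sum_range fun i => hB i k]
  exact Finset.sum_comm

theorem LinearMap.map_finsum_of_bounded {N P : Type*} [AddCommGroup N] [Module ℂ N]
    [AddCommGroup P] [Module ℂ P] (φ : N →ₗ[ℂ] P) {f : ℕ → N} {B : ℕ}
    (hf : ∀ i, B ≤ i → f i = 0) : φ (∑ᶠ i, f i) = ∑ᶠ i, φ (f i) := by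
  rw [finsum_eq_sum_range hf, finsum_eq_sum_range fun i hi => by rw [hf i hi, map_zero], map_sum]

variable {V : Type*} [AddCommGroup V] [Module ℂ V] {A : VertexAlgebra V}
  {g₁ g₂ g₃ : V ≃ₗ[ℂ] V}
  {M₁ M₂ M₃ : Type*} [AddCommGroup M₁] [Module ℂ M₁] [AddCommGroup M₂] [Module ℂ M₂]
  [AddCommGroup M₃] [Module ℂ M₃]
  {W₁ : WeakTwistedModule A g₁ M₁} {W₂ : WeakTwistedModule A g₂ M₂}
  {W₃ : WeakTwistedModule A g₃ M₃}

namespace FormalOperator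

/-- `F(w₁, x) w₂` has only finitely many negative powers of `x` in each coset of `ℚ`. -/
def IsTruncated (F : FormalOperator M₁ M₂ M₃) : Prop :=
  ∀ (w₁ : M₁) (w₂ : M₂) (h : ℂ), ∃ N : ℚ, ∀ n : ℚ, N ≤ n → F (h + n) w₁ w₂ = 0

variable {F : FormalOperator M₁ M₂ M₃}

theorem IsTruncated.exists_nat (hF : F.IsTruncated) (w₁ : M₁) (w₂ : M₂) (h : ℂ) :
    ∃ B : ℕ, ∀ k : ℕ, B ≤ k → F (h + k) w₁ w₂ = 0 := by
  obtain ⟨N, hN⟩ := hF w₁ w₂ h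
  refine ⟨⌈N⌉₊, fun k hk => ?_⟩
  simpa using hN k (Nat.ceil_le.1 hk)

/-- The formal operator `e ^ (β x) F(·, x)`. -/
noncomputable def expMul (β : ℂ) (F : FormalOperator M₁ M₂ M₃) (hF : F.IsTruncated) :
    FormalOperator M₁ M₂ M₃ := fun h =>
  LinearMap.mk₂ ℂ (expMulCoeff β F h)
    -- Truncation is needed here: a `finsum` with infinite support is `0` by convention, which would
    -- break additivity.
    (fun w w' w₂ => by
      obtain ⟨B, hB⟩ := hF.exists_nat w w₂ h
      obtain ⟨C, hC⟩ := hF.exists_nat w' w₂ h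
      unfold expMulCoeff
      rw [← finsum_add_distrib]
      · simp
      · exact hasFiniteSupport_of_eventually _ B fun i hi => by rw [hB i (mod_cast hi), smul_zero]
      · exact hasFiniteSupport_of_eventually _ C fun i hi => by rw [hC i (mod_cast hi), smul_zero])
    (fun c w w₂ => by
      unfold expMulCoeff
      rw [smul_finsum]
      exact finsum_congr fun i => by simp [smul_comm c])
    (fun w w₂ w₂' => by
      obtain ⟨B, hB⟩ := hF.exists_nat w w₂ h
      obtain ⟨C, hC⟩ := hF.exists_nat w w₂' h
      unfold expMulCoeff
      rw [← finsum_add_distrib]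
      · simp
      · exact hasFiniteSupport_of_eventually _ B fun i hi => by rw [hB i (mod_cast hi), smul_zero]
      · exact hasFiniteSupport_of_eventually _ C fun i hi => by rw [hC i (mod_cast hi), smul_zero])
    (fun c w w₂ => by
      unfold expMulCoeff
      rw [smul_finsum]
      exact finsum_congr fun i => by simp [smul_comm c])

theorem expMul_apply (β : ℂ) (hF : F.IsTruncated) (h : ℂ) (w₁ : M₁) (w₂ : M₂) :
    expMul β F hF h w₁ w₂ = ∑ᶠ k : ℕ, (β ^ k / (k.factorial : ℂ)) • F (h + k) w₁ w₂ := rfl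

theorem expMul_add {G : FormalOperator M₁ M₂ M₃} (β : ℂ) (hF : F.IsTruncated)
    (hG : G.IsTruncated) (hFG : IsTruncated (F + G)) :
    expMul β (F + G) hFG = expMul β F hF + expMul β G hG := by
  funext h
  ext w₁ w₂
  obtain ⟨B, hB⟩ := hF.exists_nat w₁ w₂ h
  obtain ⟨C, hC⟩ := hG.exists_nat w₁ w₂ h
  rw [Pi.add_apply, LinearMap.add_apply, LinearMap.add_apply, expMul_apply, expMul_apply,
    expMul_apply, ← finsum_add_distrib]
  · simp
  · exact hasFiniteSupport_of_eventually _ B fun i hi => by rw [hB i (mod_cast hi), smul_zero]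
  · exact hasFiniteSupport_of_eventually _ C fun i hi => by rw [hC i (mod_cast hi), smul_zero]

theorem expMul_smul (β c : ℂ) (hF : F.IsTruncated) (hcF : IsTruncated (c • F)) :
    expMul β (c • F) hcF = c • expMul β F hF := by
  funext h
  ext w₁ w₂
  rw [Pi.smul_apply, LinearMap.smul_apply, LinearMap.smul_apply, expMul_apply, expMul_apply,
    smul_finsum]
  exact finsum_congr fun i => by simp [smul_comm c]

/-- `e^{βx}` has only nonnegative powers of `x`, so the coefficient at `h` involves `F` only at `h +
k`, `k ≥ 0`, and the same bound works. -/
theorem IsTruncated.expMul (β : ℂ) (hF : F.IsTruncated) : (expMul β F hF).IsTruncated := by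
  intro w₁ w₂ h
  obtain ⟨N, hN⟩ := hF w₁ w₂ h
  refine ⟨N, fun n hn => ?_⟩
  rw [expMul_apply]
  refine finsum_eq_zero_of_forall_eq_zero fun k => ?_
  have := hN (n + k) (by have : (0 : ℚ) ≤ k := by positivity
                         linarith)
  push_cast at this
  rw [add_assoc, this, smul_zero]

/-- The coefficient of `X^n` in `e^{-βX} e^{βX} = 1`. -/
theorem sum_antidiagonal_exp_mul_exp_neg (β : ℂ) (n : ℕ) :
    ∑ k ∈ Finset.range (n + 1), ((-β) ^ k / (k.factorial : ℂ)) *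
      (β ^ (n - k) / ((n - k).factorial : ℂ)) = if n = 0 then 1 else 0 := by
  have h := PowerSeries.exp_mul_exp_eq_exp_add (A := ℂ) (-β) β
  have h' := congrArg (PowerSeries.coeff n) h
  rw [PowerSeries.coeff_mul, Finset.Nat.sum_antidiagonal_eq_sum_range_succ_mk] at h'
  simp only [PowerSeries.coeff_rescale, PowerSeries.coeff_exp, neg_add_cancel] at h'
  rcases eq_or_ne n 0 with rfl | hn
  · simp
  · simpa [hn, div_eq_mul_inv] using h'

theorem expMul_neg_expMul (β : ℂ) (hF : F.IsTruncated) :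
    FormalOperator.expMul (-β) (FormalOperator.expMul β F hF) (hF.expMul β) = F := by
  funext h
  ext w₁ w₂
  obtain ⟨B, hB⟩ := hF.exists_nat w₁ w₂ h
  -- Cutting the inner sum at `B - k` makes the double sum run over the triangle `k + j < B`, ready
  -- for summation along the diagonals `k + j = n`.
  have hinner : ∀ k : ℕ, FormalOperator.expMul β F hF (h + k) w₁ w₂ =
      ∑ j ∈ Finset.range (B - k), (β ^ j / (j.factorial : ℂ)) • F (h + (k + j : ℕ)) w₁ w₂ := by
    intro k
    rw [expMul_apply, finsum_eq_sum_range (B := B - k)]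
    · simp only [Nat.cast_add, add_assoc]
    · intro j hj
      have := hB (k + j) (by omega)
      push_cast at this
      rw [add_assoc, this, smul_zero]
  rw [expMul_apply, finsum_eq_sum_range (B := B) fun k hk => by
    rw [hinner, Nat.sub_eq_zero_of_le hk]; simp]
  simp_rw [hinner, Finset.smul_sum, smul_smul]
  rw [← Finset.sum_range_diag_flip B fun k j => ((-β) ^ k / (k.factorial : ℂ) *
    (β ^ j / (j.factorial : ℂ))) • F (h + (k + j : ℕ)) w₁ w₂]
  have hdiag : ∀ n ∈ Finset.range B, ∑ k ∈ Finset.range (n + 1), ((-β) ^ k / (k.factorial : ℂ) *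
      (β ^ (n - k) / ((n - k).factorial : ℂ))) • F (h + (k + (n - k) : ℕ)) w₁ w₂ =
      if n = 0 then F h w₁ w₂ else 0 := by
    intro n _
    rw [Finset.sum_congr rfl fun k hk => by
      rw [Nat.add_sub_cancel' (Nat.lt_succ_iff.1 (Finset.mem_range.1 hk))], ← Finset.sum_smul,
      sum_antidiagonal_exp_mul_exp_neg]
    rcases eq_or_ne n 0 with rfl | hn
    · simp
    · simp [hn]
  rw [Finset.sum_congr rfl hdiag, Finset.sum_ite_eq']
  split_ifs with h0
  · rfl
  -- Here `B = 0`: the sum is empty, and `F h w₁ w₂` vanishes by truncation.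
  · have := hB 0 (by simpa using h0)
    simpa using this.symm

/-! ### Compatibility with the three terms of the Jacobi identity and with `d/dx`. -/

/-- Multiplying by `x₂^k` shifts `n` to `n + k`. The double sum meets `F` only at `n + i + k`, so
one truncation bound controls both indices. -/
theorem jacobiFst_expMul (β : ℂ) (hF : F.IsTruncated) (v : V) (w₁ : M₁) (w₂ : M₂) (l m : ℚ)
    (n : ℂ) : jacobiFst W₃ (FormalOperator.expMul β F hF) v w₁ w₂ l m n =
      ∑ᶠ k : ℕ, (β ^ k / (k.factorial : ℂ)) • jacobiFst W₃ F v w₁ w₂ l m (n + k) := by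
  obtain ⟨B, hB⟩ := hF.exists_nat w₁ w₂ n
  have hz : ∀ i k : ℕ, B ≤ i + k → F (n + i + k) w₁ w₂ = 0 := fun i k hik => by
    have := hB (i + k) hik
    push_cast at this
    rwa [add_assoc]
  unfold jacobiFst
  simp_rw [smul_finsum]
  rw [← finsum_comm_of_bounded (B := B) (C := B)]
  · refine finsum_congr fun i => ?_
    rw [expMul_apply, LinearMap.map_finsum_of_bounded _ (B := B) fun k hk => by
      rw [hz i k (by omega), smul_zero], smul_finsum]
    refine finsum_congr fun k => ?_
    rw [map_smul, smul_comm, add_right_comm]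
  · intro i k hi
    rw [add_right_comm, hz i k (by omega), map_zero, smul_zero, smul_zero]
  · intro i k hk
    rw [add_right_comm, hz i k (by omega), map_zero, smul_zero, smul_zero]

/-- Common core of the second and third Jacobi terms: module truncation leaves finitely many `i`,
and the maximum of their bounds, the `sup` of `C`, limits `k` uniformly. -/
theorem finsum_expMul_comm (β : ℂ) (hF : F.IsTruncated) (c : ℕ → ℂ) (t : ℕ → ℂ) (a : ℕ → M₁)
    (b : ℕ → M₂) (hab : ∃ B : ℕ, ∀ i, B ≤ i → a i = 0 ∨ b i = 0) :
    ∑ᶠ i, c i • FormalOperator.expMul β F hF (t i) (a i) (b i) =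
      ∑ᶠ k : ℕ, (β ^ k / (k.factorial : ℂ)) • ∑ᶠ i, c i • F (t i + k) (a i) (b i) := by
  obtain ⟨B, hB⟩ := hab
  choose C hC using fun i => hF.exists_nat (a i) (b i) (t i)
  have hz : ∀ i, B ≤ i → ∀ h, F h (a i) (b i) = 0 := fun i hi h => by
    rcases hB i hi with h0 | h0 <;> simp [h0]
  simp_rw [smul_finsum]
  rw [← finsum_comm_of_bounded (B := B) (C := (Finset.range B).sup C)]
  · refine finsum_congr fun i => ?_
    rw [expMul_apply, smul_finsum]
    exact finsum_congr fun k => smul_comm _ _ _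
  · intro i k hi
    rw [hz i hi, smul_zero, smul_zero]
  · intro i k hk
    by_cases hi : i < B
    · rw [hC i k ((Finset.le_sup (Finset.mem_range.2 hi)).trans hk), smul_zero, smul_zero]
    · rw [hz i (not_lt.1 hi), smul_zero, smul_zero]

theorem _root_.WeakTwistedModule.exists_nat_mode_eq_zero {g : V ≃ₗ[ℂ] V} {M : Type*}
    [AddCommGroup M] [Module ℂ M] (W : WeakTwistedModule A g M) (v : V) (w : M) (m : ℚ) :
    ∃ B : ℕ, ∀ i : ℕ, B ≤ i → W.mode (m + i) v w = 0 := by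
  obtain ⟨N, hN⟩ := W.truncation v w
  refine ⟨⌈N - m⌉₊, fun i hi => hN _ ?_⟩
  have := Nat.ceil_le.1 hi
  linarith

theorem jacobiSnd_expMul (β : ℂ) (hF : F.IsTruncated) (v : V) (w₁ : M₁) (w₂ : M₂) (l m : ℚ)
    (n : ℂ) : jacobiSnd W₂ (FormalOperator.expMul β F hF) v w₁ w₂ l m n =
      ∑ᶠ k : ℕ, (β ^ k / (k.factorial : ℂ)) • jacobiSnd W₂ F v w₁ w₂ l m (n + k) := by
  unfold jacobiSnd
  obtain ⟨B, hB⟩ := W₂.exists_nat_mode_eq_zero v w₂ m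
  rw [finsum_expMul_comm β hF _ _ (fun _ => w₁) _ ⟨B, fun i hi => Or.inr (hB i hi)⟩]
  refine finsum_congr fun k => congrArg _ (finsum_congr fun i => ?_)
  rw [show n + l - i + k = n + k + l - i by ring]

theorem jacobiTrd_expMul (β : ℂ) (hF : F.IsTruncated) (v : V) (w₁ : M₁) (w₂ : M₂) (l m : ℚ)
    (n : ℂ) : jacobiTrd W₁ (FormalOperator.expMul β F hF) v w₁ w₂ l m n =
      ∑ᶠ k : ℕ, (β ^ k / (k.factorial : ℂ)) • jacobiTrd W₁ F v w₁ w₂ l m (n + k) := by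
  unfold jacobiTrd
  obtain ⟨B, hB⟩ := W₁.exists_nat_mode_eq_zero v w₁ l
  rw [finsum_expMul_comm β hF _ _ _ (fun _ => w₂) ⟨B, fun i hi => Or.inl (hB i hi)⟩]
  refine finsum_congr fun k => congrArg _ (finsum_congr fun i => ?_)
  rw [show m + n - i + k = m + (n + k) - i by ring]

theorem exists_nat_jacobiFst_eq_zero (hF : F.IsTruncated) (v : V) (w₁ : M₁) (w₂ : M₂) (l m : ℚ)
    (n : ℂ) : ∃ B : ℕ, ∀ k : ℕ, B ≤ k → jacobiFst W₃ F v w₁ w₂ l m (n + k) = 0 := by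
  obtain ⟨B, hB⟩ := hF.exists_nat w₁ w₂ n
  refine ⟨B, fun k hk => finsum_eq_zero_of_forall_eq_zero fun i => ?_⟩
  have := hB (k + i) (by omega)
  push_cast at this
  rw [add_assoc, this, map_zero, smul_zero]

theorem exists_nat_jacobiSnd_eq_zero (hF : F.IsTruncated) (v : V) (w₁ : M₁) (w₂ : M₂) (l m : ℚ)
    (n : ℂ) : ∃ B : ℕ, ∀ k : ℕ, B ≤ k → jacobiSnd W₂ F v w₁ w₂ l m (n + k) = 0 := by
  obtain ⟨B, hB⟩ := W₂.exists_nat_mode_eq_zero v w₂ m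
  choose C hC using fun i : ℕ => hF.exists_nat w₁ (W₂.mode (m + i) v w₂) (n + l - i)
  refine ⟨(Finset.range B).sup C, fun k hk => finsum_eq_zero_of_forall_eq_zero fun i => ?_⟩
  by_cases hi : i < B
  · have := hC i k ((Finset.le_sup (Finset.mem_range.2 hi)).trans hk)
    rw [show n + k + l - i = n + l - i + k by ring, this, smul_zero]
  · rw [hB i (not_lt.1 hi), map_zero, smul_zero]

/-- The left-hand side of the Jacobi identity is compatible with multiplication by
`e ^ (β x₂)`. -/
theorem jacobi_lhs_expMul (β : ℂ) (hF : F.IsTruncated) (v : V) (w₁ : M₁) (w₂ : M₂) (l m : ℚ)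
    (n c : ℂ) :
    jacobiFst W₃ (FormalOperator.expMul β F hF) v w₁ w₂ l m n
      - c • jacobiSnd W₂ (FormalOperator.expMul β F hF) v w₁ w₂ l m n =
    ∑ᶠ k : ℕ, (β ^ k / (k.factorial : ℂ)) •
      (jacobiFst W₃ F v w₁ w₂ l m (n + k) - c • jacobiSnd W₂ F v w₁ w₂ l m (n + k)) := by
  obtain ⟨B, hB⟩ := exists_nat_jacobiFst_eq_zero (W₃ := W₃) hF v w₁ w₂ l m n
  obtain ⟨C, hC⟩ := exists_nat_jacobiSnd_eq_zero (W₂ := W₂) hF v w₁ w₂ l m n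
  rw [jacobiFst_expMul, jacobiSnd_expMul, smul_finsum, ← finsum_sub_distrib]
  · exact finsum_congr fun k => by rw [smul_sub, smul_comm c]
  · exact hasFiniteSupport_of_eventually _ B fun k hk => by rw [hB k (mod_cast hk), smul_zero]
  · exact hasFiniteSupport_of_eventually _ C fun k hk => by
      rw [hC k (mod_cast hk), smul_zero, smul_zero]

/-- `d/dx (e ^ (β x) F) = e ^ (β x) (dF/dx + β F)`, in coefficients. -/
theorem expMul_derivative (β : ℂ) (hF : F.IsTruncated) (w w' : M₁) (w₂ : M₂)
    (hd : ∀ h : ℂ, F h w' w₂ = -h • F (h - 1) w w₂ + β • F h w w₂) (h : ℂ) :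
    FormalOperator.expMul β F hF h w' w₂ =
      -h • FormalOperator.expMul β F hF (h - 1) w w₂ := by
  obtain ⟨B, hB⟩ := hF.exists_nat w w₂ (h - 1)
  have hB' : ∀ k : ℕ, B ≤ k → F (h + k) w w₂ = 0 := fun k hk => by
    have := hB (k + 1) (by omega)
    push_cast at this
    rwa [show h - 1 + (k + 1) = h + (k : ℂ) by ring] at this
  -- The sum telescopes: the part `-k` of the factor `-(h + k)` in term `k` cancels the `β`-part of
  -- term `k - 1`. Only the `β`-part of the top term survives, and it vanishes at `n = B`.
  have hpart : ∀ n : ℕ, ∑ k ∈ Finset.range (n + 1), (β ^ k / (k.factorial : ℂ)) • F (h + k) w' w₂ =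
      -h • ∑ k ∈ Finset.range (n + 1), (β ^ k / (k.factorial : ℂ)) • F (h - 1 + k) w w₂ +
      (β * (β ^ n / (n.factorial : ℂ))) • F (h + n) w w₂ := by
    intro n
    induction n with
    | zero => simp [hd h]
    | succ n ih =>
      rw [Finset.sum_range_succ, ih, Finset.sum_range_succ _ (n + 1), hd]
      have e : h + (n + 1 : ℕ) - 1 = h + n := by push_cast; ring
      have e' : h - 1 + (n + 1 : ℕ) = h + n := by push_cast; ring
      rw [e, e']
      have hf : ((n + 1).factorial : ℂ) = (n + 1) * n.factorial := by
        rw [Nat.factorial_succ]; push_cast; ring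
      have hn : (n : ℂ) + 1 ≠ 0 := Nat.cast_add_one_ne_zero n
      have hn' : (n.factorial : ℂ) ≠ 0 := Nat.cast_ne_zero.2 n.factorial_ne_zero
      rw [hf]
      match_scalars
      · ring
      · field_simp
        ring
      · field_simp
  have hw' : ∀ k : ℕ, B + 1 ≤ k → F (h + k) w' w₂ = 0 := fun k hk => by
    rw [hd, hB' k (by omega), show h + (k : ℂ) - 1 = h - 1 + k by ring, hB k (by omega)]
    simp
  rw [expMul_apply, expMul_apply, finsum_eq_sum_range (B := B + 1) fun k hk => by
    rw [hw' k hk, smul_zero], finsum_eq_sum_range (B := B + 1) fun k hk => by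
    rw [hB k (by omega), smul_zero], hpart, hB' B le_rfl, smul_zero, add_zero]

end FormalOperator

/-! ### The isomorphism of spaces of intertwining operators. -/

open FormalOperator

theorem IsIntertwining.isTruncated {ω : V} {T : ℕ} {F : FormalOperator M₁ M₂ M₃}
    (hF : IsIntertwining W₁ W₂ W₃ ω T F) : F.IsTruncated :=
  hF.truncation

/-- Multiplication by `e ^ (β x)` turns intertwining operators for `ω` into intertwining operators
for `ω'` if `L'(-1) = L(-1) + β` on the first module. -/
theorem IsIntertwining.expMul {ω ω' : V} {T : ℕ} {F : FormalOperator M₁ M₂ M₃} {β : ℂ}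
    (hβ : ∀ w : M₁, W₁.L ω' (-1) w = W₁.L ω (-1) w + β • w)
    (hF : IsIntertwining W₁ W₂ W₃ ω T F) :
    IsIntertwining W₁ W₂ W₃ ω' T (FormalOperator.expMul β F hF.isTruncated) where
  truncation := IsTruncated.expMul β hF.isTruncated
  jacobi j₁ j₂ v hv w₁ w₂ p m n hm := by
    -- Only `n` is shifted; `p` and `m` stay fixed, so the coset condition on `m` and the phase are
    -- the same in every summand.
    rw [jacobi_lhs_expMul, jacobiTrd_expMul]
    exact finsum_congr fun k => by rw [hF.jacobi j₁ j₂ v hv w₁ w₂ p m _ hm]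
  jacobi_vanish j₁ j₂ v hv w₁ w₂ p m n hm := by
    rw [jacobi_lhs_expMul]
    exact finsum_eq_zero_of_forall_eq_zero fun k => by
      rw [hF.jacobi_vanish j₁ j₂ v hv w₁ w₂ p m _ hm, smul_zero]
  derivative w₁ h := by
    ext w₂
    refine expMul_derivative β hF.isTruncated w₁ _ w₂ (fun h => ?_) h
    rw [hβ, map_add, map_smul, hF.derivative]
    rfl

variable (W₂ W₃) in
/-- Multiplication by `e ^ (β x)` as an isomorphism of spaces of intertwining operators. -/
noncomputable def intertwiningEquiv {ω ω' : V} (T : ℕ) {β : ℂ}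
    (hβ : ∀ w : M₁, W₁.L ω' (-1) w = W₁.L ω (-1) w + β • w) :
    intertwiningSpace W₁ W₂ W₃ ω T ≃ₗ[ℂ] intertwiningSpace W₁ W₂ W₃ ω' T where
  toFun F := ⟨FormalOperator.expMul β F.1 F.2.isTruncated, F.2.expMul hβ⟩
  invFun F := ⟨FormalOperator.expMul (-β) F.1 F.2.isTruncated,
    F.2.expMul fun w => by rw [hβ, neg_smul, add_neg_cancel_right]⟩
  map_add' F G := Subtype.ext
    (expMul_add β F.2.isTruncated G.2.isTruncated (F + G).2.isTruncated)
  map_smul' c F := Subtype.ext (expMul_smul β c F.2.isTruncated (c • F).2.isTruncated)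
  left_inv F := Subtype.ext (expMul_neg_expMul β F.2.isTruncated)
  right_inv F := Subtype.ext (by
    have := expMul_neg_expMul (-β) (F := F.1) F.2.isTruncated
    simpa only [neg_neg] using this)

end ExpMul

/-! ### The theorem, with `β = -α`. -/

theorem theorem4p6 {V M₁ M₂ M₃ : Type*} [AddCommGroup V] [Module ℂ V]
    [AddCommGroup M₁] [Module ℂ M₁] [AddCommGroup M₂] [Module ℂ M₂]
    [AddCommGroup M₃] [Module ℂ M₃]
    (A : VertexAlgebra V) (ω ω' : V) (hω : A.IsVOA ω) (hω' : A.IsVOA ω')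
    (g₁ g₂ g₃ : V ≃ₗ[ℂ] V)
    (hg₁ : A.IsConformalAutomorphism ω g₁) (hg₁' : A.IsConformalAutomorphism ω' g₁)
    (hg₂ : A.IsConformalAutomorphism ω g₂) (hg₂' : A.IsConformalAutomorphism ω' g₂)
    (hg₃ : A.IsConformalAutomorphism ω g₃) (hg₃' : A.IsConformalAutomorphism ω' g₃)
    (h₁₂ : Commute g₁ g₂) (h₁₃ : Commute g₁ g₃) (h₂₃ : Commute g₂ g₃)
    (T : ℕ) (hT : 0 < T) (hT₁ : g₁ ^ T = 1) (hT₂ : g₂ ^ T = 1) (hT₃ : g₃ ^ T = 1)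
    (W₁ : WeakTwistedModule A g₁ M₁) (W₂ : WeakTwistedModule A g₂ M₂)
    (W₃ : WeakTwistedModule A g₃ M₃) (hW₁ : W₁.IsLowestWeight ω) :
    (∃! α : ℂ, ∀ w : M₁, W₁.L ω (-1) w - W₁.L ω' (-1) w = α • w) ∧
    (∀ α : ℂ, (∀ w : M₁, W₁.L ω (-1) w - W₁.L ω' (-1) w = α • w) →
      ∃ Φ : intertwiningSpace W₁ W₂ W₃ ω T ≃ₗ[ℂ] intertwiningSpace W₁ W₂ W₃ ω' T,
        (∀ (F : intertwiningSpace W₁ W₂ W₃ ω T) (h : ℂ) (w₁ : M₁) (w₂ : M₂),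
          (Φ F : FormalOperator M₁ M₂ M₃) h w₁ w₂ =
            expMulCoeff (-α) (F : FormalOperator M₁ M₂ M₃) h w₁ w₂) ∧
        (∀ (F : intertwiningSpace W₁ W₂ W₃ ω' T) (h : ℂ) (w₁ : M₁) (w₂ : M₂),
          (Φ.symm F : FormalOperator M₁ M₂ M₃) h w₁ w₂ =
            expMulCoeff α (F : FormalOperator M₁ M₂ M₃) h w₁ w₂)) ∧
    fusionRule W₁ W₂ W₃ ω T = fusionRule W₁ W₂ W₃ ω' T := by
  have hα := hW₁.existsUnique_L_neg_one_sub hω hω' (isOfFinOrder_iff_pow_eq_one.2 ⟨T, hT, hT₁⟩)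
    hg₁.map_conformal hg₁'.map_conformal
  have hβ : ∀ α : ℂ, (∀ w : M₁, W₁.L ω (-1) w - W₁.L ω' (-1) w = α • w) →
      ∀ w : M₁, W₁.L ω' (-1) w = W₁.L ω (-1) w + (-α) • w := fun α h w => by
    rw [neg_smul, ← h w]
    abel
  refine ⟨hα, fun α h => ⟨intertwiningEquiv W₂ W₃ T (hβ α h), fun F x w₁ w₂ => rfl,
    fun F x w₁ w₂ => ?_⟩, ?_⟩
  -- The inverse equivalence multiplies by `e^{-βx}` with `β = -α`.
  · change expMulCoeff (- -α) _ x w₁ w₂ = _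
    rw [neg_neg]
  · obtain ⟨α, h, -⟩ := hα
    exact (intertwiningEquiv W₂ W₃ T (hβ α h)).rank_eq
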